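/- Let $A$ and $B$ be (not necessarily unital) $C^*$-algebras and let $\varphi\colon A\to B$ be a bounded linear map such that, for all $a,b\in A$, - $a^*b=0$ implies $\varphi(a)^*\varphi(b)=0$ ($\varphi$ preserves range-orthogonality), - $ab^*=0$ implies $\varphi(a)\varphi(b)^*=0$ ($\varphi$ preserves domain-orthogonality), - $ab=0$ implies $\varphi(a)\varphi(b)=0$ ($\varphi$ preserves zero-products). For $n\ge 1$ let $\varphi^{(n)}\colon M_n(A)\to M_n(B)$ be the map that applies $\varphi$ to every entry, where $M_n(A)$ and $M_n(B)$ carry their $C^*$-norms, and put $\|\varphi\|_{cb}:=\sup_{n\ge 1}\|\varphi^{(n)}\|$. Let $\varphi^{**}\colon A^{**}\to B^{**}$ be the bitranspose of $\varphi$, and let $1$ be the (unique) unit of the bidual $A^{**}$ with its usual (Arens) multiplication. Then $\varphi$ is completely bounded, that is, $\|\varphi\|_{cb}<\infty$, and $$\|\varphi\|_{cb}=\|\varphi\|=\|\varphi^{**}(1)\|.$$ -/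

import Mathlib

/-- `φ` preserves zero-products: `a b = 0` implies `φ(a) φ(b) = 0`. -/
def PreservesZeroProducts {A B : Type*} [NonUnitalCStarAlgebra A] [NonUnitalCStarAlgebra B]
    (φ : A → B) : Prop :=
  ∀ a b : A, a * b = 0 → φ a * φ b = 0

/-- `φ` preserves range-orthogonality: `a* b = 0` implies `φ(a)* φ(b) = 0`. -/
def PreservesRangeOrthogonality {A B : Type*} [NonUnitalCStarAlgebra A] [NonUnitalCStarAlgebra B]
    (φ : A → B) : Prop :=
  ∀ a b : A, star a * b = 0 → star (φ a) * φ b = 0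

/-- `φ` preserves domain-orthogonality: `a b* = 0` implies `φ(a) φ(b)* = 0`. -/
def PreservesDomainOrthogonality {A B : Type*} [NonUnitalCStarAlgebra A] [NonUnitalCStarAlgebra B]
    (φ : A → B) : Prop :=
  ∀ a b : A, a * star b = 0 → φ a * star (φ b) = 0

/-- The bidual `A**` of a C⋆-algebra, with the bidual norm. -/
abbrev Bidual (A : Type*) [NonUnitalCStarAlgebra A] : Type _ :=
  StrongDual ℂ (StrongDual ℂ A)

/-- The bitranspose `φ** : A** → B**`, the transpose of the transpose of `φ`. -/
noncomputable def bitranspose {A B : Type*} [NonUnitalCStarAlgebra A] [NonUnitalCStarAlgebra B]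
    (φ : A →L[ℂ] B) : Bidual A →L[ℂ] Bidual B :=
  ContinuousLinearMap.precomp ℂ (ContinuousLinearMap.precomp ℂ φ)

theorem bitranspose_apply {A B : Type*} [NonUnitalCStarAlgebra A] [NonUnitalCStarAlgebra B]
    (φ : A →L[ℂ] B) (F : Bidual A) (f : StrongDual ℂ B) :
    bitranspose φ F f = F (f ∘L φ) := rfl

/-- The right action of `A` on `A*`: the functional `f · a` is `b ↦ f (a b)`. -/
noncomputable def dualAct (A : Type*) [NonUnitalCStarAlgebra A] :
    StrongDual ℂ A →L[ℂ] A →L[ℂ] StrongDual ℂ A :=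
  (ContinuousLinearMap.compL ℂ A (A →L[ℂ] A) (StrongDual ℂ A)).flip (ContinuousLinearMap.mul ℂ A)
    ∘L ContinuousLinearMap.compL ℂ A A ℂ

theorem dualAct_apply {A : Type*} [NonUnitalCStarAlgebra A] (f : StrongDual ℂ A) (a b : A) :
    dualAct A f a b = f (a * b) := rfl

/-- The (first) Arens product on `A**`, that is, the multiplication of the C⋆-algebra `A**`
extending that of `A`:
`(F G)(f) = F (a ↦ G (f · a))`, where `f · a` is the functional `b ↦ f (a b)`. -/
noncomputable def arensMul {A : Type*} [NonUnitalCStarAlgebra A] (F G : Bidual A) : Bidual A :=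
  F ∘L ContinuousLinearMap.compL ℂ A (StrongDual ℂ A) ℂ G ∘L dualAct A

theorem arensMul_apply {A : Type*} [NonUnitalCStarAlgebra A] (F G : Bidual A)
    (f : StrongDual ℂ A) : arensMul F G f = F (G ∘L dualAct A f) := rfl

/-- `e` is the unit `1` of the algebra `A**`. -/
def IsBidualOne {A : Type*} [NonUnitalCStarAlgebra A] (e : Bidual A) : Prop :=
  ∀ F : Bidual A, arensMul e F = F ∧ arensMul F e = F

/-- The amplification `φ⁽ⁿ⁾ : M_n(A) → M_n(B)`, which applies `φ` to every entry. The type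
`CStarMatrix (Fin n) (Fin n) A` is `M_n(A)` with its C⋆-norm. -/
noncomputable def amplification {A B : Type*}
    [NonUnitalCStarAlgebra A] [PartialOrder A] [StarOrderedRing A]
    [NonUnitalCStarAlgebra B] [PartialOrder B] [StarOrderedRing B]
    (φ : A →L[ℂ] B) (n : ℕ) :
    CStarMatrix (Fin n) (Fin n) A →L[ℂ] CStarMatrix (Fin n) (Fin n) B where
  toLinearMap := CStarMatrix.mapₗ φ.toLinearMap
  cont := continuous_pi fun i => continuous_pi fun j =>
    φ.continuous.comp ((continuous_apply j).comp (continuous_apply i))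

theorem amplification_apply {A B : Type*}
    [NonUnitalCStarAlgebra A] [PartialOrder A] [StarOrderedRing A]
    [NonUnitalCStarAlgebra B] [PartialOrder B] [StarOrderedRing B]
    (φ : A →L[ℂ] B) (n : ℕ) (M : CStarMatrix (Fin n) (Fin n) A) (i j : Fin n) :
    amplification φ n M i j = φ (M i j) := rfl

/-- `φ` is completely bounded: the operator norms of its amplifications are bounded. -/
def IsCompletelyBounded {A B : Type*}
    [NonUnitalCStarAlgebra A] [PartialOrder A] [StarOrderedRing A]
    [NonUnitalCStarAlgebra B] [PartialOrder B] [StarOrderedRing B]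
    (φ : A →L[ℂ] B) : Prop :=
  BddAbove (Set.range fun n : ℕ => ‖amplification φ n‖)

/-- The completely bounded norm `‖φ‖_cb = sup_n ‖φ⁽ⁿ⁾‖`, where `n = 0` contributes `0`. It is used
for completely bounded `φ` only. -/
noncomputable def cbNorm {A B : Type*}
    [NonUnitalCStarAlgebra A] [PartialOrder A] [StarOrderedRing A]
    [NonUnitalCStarAlgebra B] [PartialOrder B] [StarOrderedRing B]
    (φ : A →L[ℂ] B) : ℝ :=
  ⨆ n : ℕ, ‖amplification φ n‖

open Filter Topology

theorem sum_range_three_mul {M : Type*} [AddCommMonoid M] (f : ℕ → M) (n : ℕ) :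
    ∑ j ∈ Finset.range (3 * n), f j = (∑ k ∈ Finset.range n, f (3 * k)) +
      (∑ k ∈ Finset.range n, f (3 * k + 1)) + ∑ k ∈ Finset.range n, f (3 * k + 2) := by
  induction n with
  | zero => simp
  | succ n ih =>
    rw [show 3 * (n + 1) = 3 * n + 1 + 1 + 1 by ring]
    simp only [Finset.sum_range_succ, ih]
    abel

section DisjointBilinear

variable {X E : Type*} [TopologicalSpace X] [NormedAddCommGroup E]
  [NormedSpace ℝ E]

/-- The part of `τ` between the levels `j` and `j + 1`. -/
def levelSlice (τ : C(X, ℝ)) (j : ℕ) : C(X, ℝ) :=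
  ⟨fun x => max 0 (min 1 (τ x - j)), by fun_prop⟩

/-- The tent function of `τ` supported between the levels `j` and `j + 2`. -/
def levelTent (τ : C(X, ℝ)) (j : ℕ) : C(X, ℝ) :=
  levelSlice τ j - levelSlice τ (j + 1)

theorem sum_levelSlice_apply (τ : C(X, ℝ)) (x : X) (m : ℕ) :
    ∑ j ∈ Finset.range m, levelSlice τ j x = max 0 (min (m : ℝ) (τ x)) := by
  induction m with
  | zero => simp
  | succ m ih =>
    rw [Finset.sum_range_succ, ih]
    simp only [levelSlice, ContinuousMap.coe_mk]
    have : (0 : ℝ) ≤ m := m.cast_nonneg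
    push_cast
    grind

theorem abs_levelTent_le (τ : C(X, ℝ)) (j : ℕ) (x : X) : |levelTent τ j x| ≤ 1 := by
  simp only [levelTent, levelSlice, ContinuousMap.sub_apply, ContinuousMap.coe_mk]
  push_cast
  grind

theorem levelTent_mul_levelSlice (τ : C(X, ℝ)) {i j : ℕ} (h : i + 2 ≤ j) :
    levelTent τ i * levelSlice τ j = 0 := by
  ext x
  simp only [levelTent, levelSlice, ContinuousMap.sub_apply, ContinuousMap.coe_mk,
    ContinuousMap.mul_apply, ContinuousMap.zero_apply, mul_eq_zero]
  have : (i : ℝ) + 2 ≤ j := by exact_mod_cast h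
  push_cast
  grind

theorem levelTent_mul_levelTent (τ : C(X, ℝ)) {i j : ℕ} (h : i + 2 ≤ j) :
    levelTent τ i * levelTent τ j = 0 := by
  rw [levelTent.eq_1 τ j, mul_sub, levelTent_mul_levelSlice τ h,
    levelTent_mul_levelSlice τ (h.trans j.le_succ), sub_zero]

theorem one_sub_levelSlice_mul (τ : C(X, ℝ)) (j : ℕ) :
    (1 - levelSlice τ j) * levelSlice τ (j + 1) = 0 := by
  ext x
  simp only [levelSlice, ContinuousMap.sub_apply, ContinuousMap.coe_mk,
    ContinuousMap.mul_apply, ContinuousMap.zero_apply, mul_eq_zero, ContinuousMap.one_apply]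
  push_cast
  grind

theorem levelSlice_zero_eq_one {τ : C(X, ℝ)} (hτ : ∀ x, 1 ≤ τ x) : levelSlice τ 0 = 1 := by
  ext x
  have := hτ x
  simp [levelSlice, this]

variable {Φ : C(X, ℝ) →ₗ[ℝ] C(X, ℝ) →ₗ[ℝ] E}

theorem bilinear_levelSlice_succ (hdisj : ∀ f g, f * g = 0 → Φ f g = 0) (τ : C(X, ℝ)) (j : ℕ) :
    Φ (levelSlice τ (j + 1)) 1 - Φ 1 (levelSlice τ (j + 1)) =
      Φ (levelTent τ (j + 1)) (levelTent τ j) - Φ (levelTent τ j) (levelTent τ (j + 1)) := by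
  have e1 : levelSlice τ (j + 1) = levelTent τ (j + 1) + levelSlice τ (j + 2) := by
    simp [levelTent]
  have e2 : (1 : C(X, ℝ)) = (1 - levelSlice τ j) + levelTent τ j + levelSlice τ (j + 1) := by
    simp [levelTent]
  have z1 := one_sub_levelSlice_mul τ j
  have z2 := levelTent_mul_levelSlice τ (le_refl (j + 2))
  have z1' := z1
  have z2' := z2
  rw [mul_comm] at z1' z2'
  have a1 : Φ (levelSlice τ (j + 1)) (levelTent τ j) =
      Φ (levelTent τ (j + 1)) (levelTent τ j) := by
    conv_lhs => rw [e1]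
    rw [map_add, LinearMap.add_apply, hdisj _ _ z2', add_zero]
  have a2 : Φ (levelTent τ j) (levelSlice τ (j + 1)) =
      Φ (levelTent τ j) (levelTent τ (j + 1)) := by
    conv_lhs => rw [e1]
    rw [map_add, hdisj _ _ z2, add_zero]
  rw [e2]
  simp only [map_add, LinearMap.add_apply]
  rw [hdisj _ _ z1, hdisj _ _ z1', a1, a2]
  abel

variable [CompactSpace X]

theorem norm_sum_le_one_of_disjoint {u : ℕ → C(X, ℝ)} (hu : ∀ k x, |u k x| ≤ 1)
    (huu : ∀ i j, i ≠ j → u i * u j = 0) (n : ℕ) :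
    ‖∑ k ∈ Finset.range n, u k‖ ≤ 1 := by
  refine (ContinuousMap.norm_le _ zero_le_one).2 fun x => ?_
  rw [ContinuousMap.sum_apply, Real.norm_eq_abs]
  by_cases h : ∃ k ∈ Finset.range n, u k x ≠ 0
  · obtain ⟨k, hk, hkx⟩ := h
    rw [Finset.sum_eq_single_of_mem k hk]
    · exact hu k x
    · intro j _ hj
      have := congrArg (fun f : C(X, ℝ) => f x) (huu j k hj)
      simpa [hkx] using this
  · push Not at h
    rw [Finset.sum_eq_zero h]
    simp

theorem norm_sum_bilinear_le {K : ℝ} (hK : 0 ≤ K) (hΦ : ∀ f g, ‖Φ f g‖ ≤ K * ‖f‖ * ‖g‖)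
    (hdisj : ∀ f g, f * g = 0 → Φ f g = 0) {u v : ℕ → C(X, ℝ)} (hu : ∀ k x, |u k x| ≤ 1) (hv : ∀ k x, |v k x| ≤ 1)
    (huu : ∀ i j, i ≠ j → u i * u j = 0) (hvv : ∀ i j, i ≠ j → v i * v j = 0)
    (huv : ∀ i j, i ≠ j → u i * v j = 0) (n : ℕ) :
    ‖∑ k ∈ Finset.range n, Φ (u k) (v k)‖ ≤ K := by
  have key : ∑ k ∈ Finset.range n, Φ (u k) (v k) =
      Φ (∑ k ∈ Finset.range n, u k) (∑ k ∈ Finset.range n, v k) := by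
    simp only [map_sum, LinearMap.sum_apply]
    refine Finset.sum_congr rfl fun k hk => ?_
    rw [Finset.sum_eq_single_of_mem k hk]
    exact fun j _ hj => hdisj _ _ (huv j k hj)
  rw [key]
  refine (hΦ _ _).trans ?_
  have h1 := norm_sum_le_one_of_disjoint hu huu n
  have h2 := norm_sum_le_one_of_disjoint hv hvv n
  calc K * _ * _ ≤ K * 1 * 1 := by gcongr
    _ = K := by ring

theorem norm_bilinear_sub_le {K : ℝ} (hK : 0 ≤ K) (hΦ : ∀ f g, ‖Φ f g‖ ≤ K * ‖f‖ * ‖g‖)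
    (hdisj : ∀ f g, f * g = 0 → Φ f g = 0) {τ : C(X, ℝ)} (hτ : ∀ x, 1 ≤ τ x) :
    ‖Φ τ 1 - Φ 1 τ‖ ≤ 6 * K := by
  obtain ⟨n, hn⟩ := exists_nat_ge ‖τ‖
  have hsum : τ = ∑ j ∈ Finset.range (3 * n + 1), levelSlice τ j := by
    ext x
    have h1 := hτ x
    have h2 : τ x ≤ n := (le_abs_self _).trans ((τ.norm_coe_le_norm x).trans hn)
    rw [ContinuousMap.sum_apply, sum_levelSlice_apply, min_eq_right, max_eq_right] <;>
      push_cast <;> linarith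
  have hdiff : Φ τ 1 - Φ 1 τ = ∑ j ∈ Finset.range (3 * n),
      (Φ (levelTent τ (j + 1)) (levelTent τ j) - Φ (levelTent τ j) (levelTent τ (j + 1))) := by
    conv_lhs => rw [hsum]
    simp only [map_sum, LinearMap.sum_apply]
    rw [← Finset.sum_sub_distrib, Finset.sum_range_succ', levelSlice_zero_eq_one hτ, sub_self,
      add_zero]
    exact Finset.sum_congr rfl fun j _ => bilinear_levelSlice_succ hdisj τ j
  have orth : ∀ i j, i + 2 ≤ j ∨ j + 2 ≤ i → levelTent τ i * levelTent τ j = 0 := by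
    rintro i j (h | h)
    · exact levelTent_mul_levelTent τ h
    · rw [mul_comm]
      exact levelTent_mul_levelTent τ h
  have blk : ∀ r s : ℕ, r + 1 = s ∨ s + 1 = r →
      ‖∑ k ∈ Finset.range n, Φ (levelTent τ (3 * k + r)) (levelTent τ (3 * k + s))‖ ≤ K := by
    intro r s hrs
    refine norm_sum_bilinear_le hK hΦ hdisj (u := fun k => levelTent τ (3 * k + r))
      (v := fun k => levelTent τ (3 * k + s)) (fun _ => abs_levelTent_le τ _)
      (fun _ => abs_levelTent_le τ _) ?_ ?_ ?_ n <;>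
    · intro i j hij
      exact orth _ _ (by omega)
  rw [hdiff, Finset.sum_sub_distrib, sum_range_three_mul, sum_range_three_mul]
  have b1 := blk 1 0 (by simp)
  have b2 := blk 2 1 (by simp)
  have b3 := blk 3 2 (by simp)
  have b4 := blk 0 1 (by simp)
  have b5 := blk 1 2 (by simp)
  have b6 := blk 2 3 (by simp)
  simp only [add_zero, add_assoc, Nat.reduceAdd] at b1 b2 b3 b4 b5 b6 ⊢
  refine (norm_sub_le _ _).trans ?_
  have t1 := norm_add₃_le
    (a := ∑ k ∈ Finset.range n, Φ (levelTent τ (3 * k + 1)) (levelTent τ (3 * k)))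
    (b := ∑ k ∈ Finset.range n, Φ (levelTent τ (3 * k + 2)) (levelTent τ (3 * k + 1)))
    (c := ∑ k ∈ Finset.range n, Φ (levelTent τ (3 * k + 3)) (levelTent τ (3 * k + 2)))
  have t2 := norm_add₃_le
    (a := ∑ k ∈ Finset.range n, Φ (levelTent τ (3 * k)) (levelTent τ (3 * k + 1)))
    (b := ∑ k ∈ Finset.range n, Φ (levelTent τ (3 * k + 1)) (levelTent τ (3 * k + 2)))
    (c := ∑ k ∈ Finset.range n, Φ (levelTent τ (3 * k + 2)) (levelTent τ (3 * k + 3)))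
  simp only [add_assoc] at t1 t2
  linarith

/-- A bounded bilinear map on `C(X, ℝ)` that vanishes on pairs with product zero is balanced. -/
theorem bilinear_apply_one_comm {K : ℝ} (hK : 0 ≤ K) (hΦ : ∀ f g, ‖Φ f g‖ ≤ K * ‖f‖ * ‖g‖)
    (hdisj : ∀ f g, f * g = 0 → Φ f g = 0) (τ : C(X, ℝ)) : Φ τ 1 = Φ 1 τ := by
  rw [← sub_eq_zero, ← norm_eq_zero]
  refine le_antisymm (le_of_forall_pos_le_add fun ε hε => ?_) (norm_nonneg _)
  obtain ⟨N, hN⟩ := exists_nat_gt (6 * K / ε)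
  have hN0 : (0 : ℝ) < N := lt_of_le_of_lt (by positivity) hN
  have h := norm_bilinear_sub_le hK hΦ hdisj
    (τ := (N : ℝ) • τ + (1 + N * ‖τ‖) • (1 : C(X, ℝ))) fun x => by
      have := (abs_le.1 (τ.norm_coe_le_norm x)).1
      simp only [ContinuousMap.add_apply, ContinuousMap.smul_apply, ContinuousMap.one_apply,
        smul_eq_mul]
      nlinarith
  simp only [map_add, map_smul, LinearMap.add_apply, LinearMap.smul_apply,
    add_sub_add_right_eq_sub, ← smul_sub] at h
  rw [norm_smul, Real.norm_of_nonneg hN0.le] at h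
  rw [div_lt_iff₀ hε] at hN
  nlinarith

end DisjointBilinear

section Balanced

open Unitization

variable {A B : Type*} [NonUnitalCStarAlgebra A] [NonUnitalCStarAlgebra B]

/-- Left multiplication of elements of `A` by an element of the unitization of `A`. -/
noncomputable def unitizationSmul (a : A) : Unitization ℂ A →ₗ[ℂ] A where
  toFun m := (m * (a : Unitization ℂ A)).snd
  map_add' m n := by rw [add_mul, snd_add]
  map_smul' r m := by rw [smul_mul_assoc, snd_smul, RingHom.id_apply]

theorem inr_unitizationSmul (m : Unitization ℂ A) (a : A) :
    (unitizationSmul a m : Unitization ℂ A) = m * (a : Unitization ℂ A) := by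
  ext <;> simp [unitizationSmul]

theorem norm_unitizationSmul_le (m : Unitization ℂ A) (a : A) :
    ‖unitizationSmul a m‖ ≤ ‖m‖ * ‖a‖ := by
  rw [← norm_inr (𝕜 := ℂ), inr_unitizationSmul, ← norm_inr (𝕜 := ℂ) (a := a)]
  exact norm_mul_le _ _

theorem balanced_of_isSelfAdjoint {φ : A →L[ℂ] B} (hφ : PreservesRangeOrthogonality φ)
    {b : A} (hb : IsSelfAdjoint b) (a c : A) :
    star (φ (b * a)) * φ c = star (φ a) * φ (b * c) := by
  have hb' : IsSelfAdjoint (b : Unitization ℂ A) := hb.inr ℂ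
  let L : C(spectrum ℝ (b : Unitization ℂ A), ℝ) →⋆ₐ[ℝ] Unitization ℂ A := cfcHom hb'
  have hL : ∀ f, ‖L f‖ = ‖f‖ := fun f => norm_cfcHom (b : Unitization ℂ A) f hb'
  have hLstar : ∀ f, star (L f) = L f := fun f => by
    rw [← map_star, star_trivial]
  let Φ : C(spectrum ℝ (b : Unitization ℂ A), ℝ) →ₗ[ℝ]
      C(spectrum ℝ (b : Unitization ℂ A), ℝ) →ₗ[ℝ] B :=
    LinearMap.mk₂ ℝ
      (fun f g => star (φ (unitizationSmul a (L f))) * φ (unitizationSmul c (L g)))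
      (fun _ _ _ => by simp only [map_add, star_add, add_mul])
      (fun r f g => by
        rw [map_smul, ← Complex.coe_smul, map_smul, map_smul, star_smul, smul_mul_assoc]
        simp [Complex.coe_smul])
      (fun _ _ _ => by simp only [map_add, mul_add])
      (fun r f g => by
        rw [map_smul, ← Complex.coe_smul, map_smul, map_smul, mul_smul_comm, Complex.coe_smul])
  have hbound : ∀ f g, ‖Φ f g‖ ≤ (‖φ‖ * ‖a‖ * (‖φ‖ * ‖c‖)) * ‖f‖ * ‖g‖ := fun f g => by
    have h1 : ‖φ (unitizationSmul a (L f))‖ ≤ ‖φ‖ * (‖f‖ * ‖a‖) :=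
      (φ.le_opNorm _).trans (by gcongr; rw [← hL f]; exact norm_unitizationSmul_le _ _)
    have h2 : ‖φ (unitizationSmul c (L g))‖ ≤ ‖φ‖ * (‖g‖ * ‖c‖) :=
      (φ.le_opNorm _).trans (by gcongr; rw [← hL g]; exact norm_unitizationSmul_le _ _)
    calc ‖Φ f g‖ ≤ ‖star (φ (unitizationSmul a (L f)))‖ * ‖φ (unitizationSmul c (L g))‖ :=
          norm_mul_le _ _
      _ ≤ (‖φ‖ * (‖f‖ * ‖a‖)) * (‖φ‖ * (‖g‖ * ‖c‖)) := by
          rw [norm_star]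
          gcongr
      _ = _ := by ring
  have hdisj : ∀ f g, f * g = 0 → Φ f g = 0 := fun f g hfg => by
    refine hφ _ _ (inr_injective (R := ℂ) ?_)
    rw [inr_mul, inr_star, inr_unitizationSmul, inr_unitizationSmul, star_mul, hLstar, mul_assoc,
      ← mul_assoc (L f), ← map_mul, hfg, map_zero, zero_mul, mul_zero, inr_zero]
  have key := bilinear_apply_one_comm (by positivity) hbound hdisj
    ((ContinuousMap.id ℝ).restrict _)
  have hid : L ((ContinuousMap.id ℝ).restrict _) = (b : Unitization ℂ A) := cfcHom_id hb'
  have hmul : ∀ x : A, unitizationSmul x (b : Unitization ℂ A) = b * x := fun x =>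
    inr_injective (R := ℂ) (by rw [inr_unitizationSmul, inr_mul])
  have hone : ∀ x : A, unitizationSmul x (1 : Unitization ℂ A) = x := fun x =>
    inr_injective (R := ℂ) (by rw [inr_unitizationSmul, one_mul])
  simpa only [Φ, LinearMap.mk₂_apply, hid, map_one, hmul, hone] using key

/-- A bounded map preserving range-orthogonality satisfies `φ(b* a)* φ(c) = φ(a)* φ(b c)`. -/
theorem balanced_of_preservesRangeOrthogonality {φ : A →L[ℂ] B}
    (hφ : PreservesRangeOrthogonality φ) (a b c : A) :
    star (φ (star b * a)) * φ c = star (φ a) * φ (b * c) := by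
  have h1 := balanced_of_isSelfAdjoint hφ (realPart b).2 a c
  have h2 := balanced_of_isSelfAdjoint hφ (imaginaryPart b).2 a c
  have hb := realPart_add_I_smul_imaginaryPart b
  have hb' : star b = (realPart b : A) - Complex.I • (imaginaryPart b : A) := by
    conv_lhs => rw [← hb]
    rw [star_add, star_smul, (realPart b).2.star_eq, (imaginaryPart b).2.star_eq]
    simp [sub_eq_add_neg]
  rw [hb']
  conv_rhs => rw [← hb]
  simp only [sub_mul, add_mul, smul_mul_assoc, map_sub, map_add, map_smul, star_sub, star_smul,
    mul_add, mul_smul_comm, h1, h2]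
  simp

end Balanced

theorem eq_of_isBidualOne {A : Type*} [NonUnitalCStarAlgebra A] {e e' : Bidual A}
    (h : IsBidualOne e) (h' : IsBidualOne e') :
    e = e' := by
  rw [← (h' e).2, (h e').1]

theorem exists_norm_le_one_norm_add_mul_eq (a b : ℂ) :
    ∃ α : ℂ, ‖α‖ ≤ 1 ∧ ‖a + α * b‖ = ‖a‖ + ‖b‖ := by
  by_cases ha : a = 0
  · exact ⟨1, by simp, by simp [ha]⟩
  by_cases hb : b = 0
  · exact ⟨1, by simp, by simp [hb]⟩
  have ha' : (‖a‖ : ℂ) ≠ 0 := by simpa using ha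
  refine ⟨a * ‖b‖ / (‖a‖ * b), ?_, ?_⟩
  · have h1 := norm_ne_zero_iff.2 ha
    have h2 := norm_ne_zero_iff.2 hb
    simp only [norm_div, norm_mul, Complex.norm_real, norm_norm]
    rw [div_self (mul_ne_zero h1 h2)]
  · have : a + a * ‖b‖ / (‖a‖ * b) * b = (a / ‖a‖) * ((‖a‖ + ‖b‖ : ℝ) : ℂ) := by
      push_cast
      field_simp
    rw [this, norm_mul, norm_div, Complex.norm_real, norm_norm,
      div_self (norm_ne_zero_iff.2 ha), one_mul, Complex.norm_real, Real.norm_of_nonneg]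
    positivity

section BidualUnit

variable {A : Type*} [NonUnitalCStarAlgebra A] [PartialOrder A] [StarOrderedRing A]

theorem mul_self_le_self_of_norm_le_one {u : A} (hu : 0 ≤ u) (hu1 : ‖u‖ ≤ 1) : u * u ≤ u := by
  open Unitization in
  rw [← inr_le_iff _ _ (by rw [IsSelfAdjoint, star_mul, hu.isSelfAdjoint.star_eq])
    hu.isSelfAdjoint, inr_mul]
  have h0 : 0 ≤ (u : Unitization ℂ A) := Unitization.inr_nonneg_iff.2 hu
  have h1 : (u : Unitization ℂ A) ≤ 1 := by
    rwa [← CStarAlgebra.norm_le_one_iff_of_nonneg _, Unitization.norm_inr]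
  simpa [sq] using CStarAlgebra.pow_antitone h0 h1 one_le_two

/-- A convex combination `u x + (1 - u) w` with `0 ≤ u ≤ 1` has norm at most that of `(x, w)`. -/
theorem norm_sq_mul_add_sub_mul_le {u : A} (hu : 0 ≤ u) (hu1 : ‖u‖ ≤ 1) (x w : A) :
    ‖u * x + (w - u * w)‖ ^ 2 ≤ ‖x‖ ^ 2 + ‖w‖ ^ 2 := by
  have hs := hu.isSelfAdjoint.star_eq
  have hle := mul_self_le_self_of_norm_le_one hu hu1
  have e1 : star (u * x + (w - u * w)) * (u * x + (w - u * w)) ≤ star x * x + star w * w := by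
    have c1 : 0 ≤ star (x - w) * (u - u * u) * (x - w) :=
      star_left_conjugate_nonneg (sub_nonneg.2 hle) _
    have c2 : star x * u * x ≤ star x * x := by
      refine (CStarAlgebra.star_left_conjugate_le_norm_smul (a := x) (b := u)).trans ?_
      exact smul_le_of_le_one_left (star_mul_self_nonneg x) hu1
    have c3 : 0 ≤ star w * u * w := star_left_conjugate_nonneg hu w
    rw [← sub_nonneg] at c2 ⊢
    convert add_nonneg (add_nonneg c1 c2) c3 using 1
    simp only [star_add, star_sub, star_mul, hs]
    noncomm_ring
  calc ‖u * x + (w - u * w)‖ ^ 2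
      = ‖star (u * x + (w - u * w)) * (u * x + (w - u * w))‖ := by
        rw [CStarRing.norm_star_mul_self, sq]
    _ ≤ ‖star x * x + star w * w‖ :=
        CStarAlgebra.norm_le_norm_of_nonneg_of_le (star_mul_self_nonneg _) e1
    _ ≤ ‖star x * x‖ + ‖star w * w‖ := norm_add_le _ _
    _ = _ := by rw [CStarRing.norm_star_mul_self, CStarRing.norm_star_mul_self, sq, sq]

/-- If `0 ≤ u ≤ 1` almost preserves a vector at which `f` is almost extremal, then `f` almost
vanishes on `(1 - u) A`. -/
theorem norm_sub_dualAct_le {u : A} (hu : 0 ≤ u) (hu1 : ‖u‖ ≤ 1) {f : StrongDual ℂ A} {x : A}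
    (hx : ‖x‖ ≤ 1) {δ : ℝ} (hδ : 0 < δ) (hfx : ‖f‖ - δ ^ 2 ≤ ‖f (u * x)‖) :
    ‖f - dualAct A f u‖ ≤ δ * (1 + ‖f‖) := by
  refine ContinuousLinearMap.opNorm_le_of_unit_norm (by positivity) fun y hy => ?_
  obtain ⟨α, hα, hαe⟩ := exists_norm_le_one_norm_add_mul_eq (f (u * x)) (δ * f (y - u * y))
  set w : A := (α * δ) • y with hw
  have hwn : ‖w‖ ≤ δ := by
    rw [hw, norm_smul, norm_mul, hy, mul_one, Complex.norm_real, Real.norm_of_nonneg hδ.le]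
    exact mul_le_of_le_one_left hδ.le hα
  have h1 := norm_sq_mul_add_sub_mul_le hu hu1 x w
  have h2 : ‖u * x + (w - u * w)‖ ≤ 1 + δ ^ 2 := by
    refine le_of_sq_le_sq (h1.trans ?_) (by positivity)
    have := norm_nonneg x
    have := norm_nonneg w
    nlinarith [sq_nonneg (δ ^ 2)]
  have h3 : f (u * x + (w - u * w)) = f (u * x) + α * (δ * f (y - u * y)) := by
    rw [map_add, hw, mul_smul_comm, ← smul_sub, map_smul, smul_eq_mul, mul_assoc]
  have h4 := (f.le_opNorm (u * x + (w - u * w))).trans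
    (mul_le_mul_of_nonneg_left h2 (norm_nonneg f))
  rw [h3, hαe, norm_mul, Complex.norm_real, Real.norm_of_nonneg hδ.le] at h4
  rw [sub_apply, dualAct_apply, ← map_sub]
  refine le_of_mul_le_mul_left ?_ hδ
  linarith

theorem tendsto_dualAct {l : Filter A} (hl : l.IsIncreasingApproximateUnit)
    (f : StrongDual ℂ A) : Tendsto (fun u => dualAct A f u) l (𝓝 f) := by
  rw [tendsto_iff_norm_sub_tendsto_zero, Metric.tendsto_nhds]
  intro ε hε
  obtain ⟨δ, hδ, hδε⟩ : ∃ δ : ℝ, 0 < δ ∧ δ * (1 + ‖f‖) < ε := by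
    have hf : 0 < 1 + ‖f‖ := by positivity
    refine ⟨ε / (2 * (1 + ‖f‖)), by positivity, ?_⟩
    field_simp
    linarith
  obtain ⟨x, hx, hfx⟩ := f.exists_lt_apply_of_lt_opNorm
    (show ‖f‖ - δ ^ 2 < ‖f‖ from sub_lt_self _ (by positivity))
  have ht : Tendsto (fun u => ‖f (u * x)‖) l (𝓝 ‖f x‖) :=
    ((f.continuous.tendsto x).comp (hl.tendsto_mul_right x)).norm
  filter_upwards [hl.eventually_nonneg, hl.eventually_norm, ht.eventually (lt_mem_nhds hfx)]
    with u hu hu1 hux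
  rw [dist_zero_right, norm_norm, norm_sub_rev]
  exact (norm_sub_dualAct_le hu hu1 hx.le hδ hux.le).trans_lt hδε

theorem isBidualOne_of_tendsto {l : Filter A} (hl : l.IsIncreasingApproximateUnit)
    {e : Bidual A} (he : ∀ f : StrongDual ℂ A, Tendsto (fun u => f u) l (𝓝 (e f))) :
    IsBidualOne e := by
  have := hl.neBot
  intro F
  constructor
  · ext f
    rw [arensMul_apply]
    exact tendsto_nhds_unique (he (F ∘L dualAct A f))
      ((F.continuous.tendsto f).comp (tendsto_dualAct hl f))
  · ext f
    rw [arensMul_apply]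
    congr 1
    ext a
    refine tendsto_nhds_unique (he (dualAct A f a)) ?_
    exact (f.continuous.tendsto a).comp (hl.tendsto_mul_left a)

variable (A) in
/-- A weak-star limit point of the canonical approximate unit in the bidual. -/
theorem exists_tendsto_bidual : ∃ (l : Filter A) (e : Bidual A), l.IsIncreasingApproximateUnit ∧
    ‖e‖ ≤ 1 ∧ ∀ f : StrongDual ℂ A, Tendsto (fun u => f u) l (𝓝 (e f)) := by
  have hl := CStarAlgebra.increasingApproximateUnit A
  let U : Ultrafilter A := Ultrafilter.of (CStarAlgebra.approximateUnit A)
  have hU : (U : Filter A) ≤ CStarAlgebra.approximateUnit A := Ultrafilter.of_le _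
  let ι : A → WeakDual ℂ (StrongDual ℂ A) := fun a =>
    StrongDual.toWeakDual (NormedSpace.inclusionInDoubleDual ℂ A a)
  have hmem : ((U.map ι : Ultrafilter _) : Filter _) ≤
      𝓟 (WeakDual.toStrongDual ⁻¹' Metric.closedBall (0 : Bidual A) 1) := by
    rw [Ultrafilter.coe_map, le_principal_iff, Filter.mem_map]
    filter_upwards [hU hl.eventually_norm] with u hu
    have h : ‖NormedSpace.inclusionInDoubleDual ℂ A u‖ ≤ 1 :=
      (NormedSpace.double_dual_bound ℂ A u).trans hu
    exact (mem_closedBall_zero_iff (E := Bidual A)).2 h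
  obtain ⟨e, he, hle⟩ := (WeakDual.isCompact_closedBall (0 : Bidual A) 1).ultrafilter_le_nhds _ hmem
  refine ⟨U, WeakDual.toStrongDual e, ⟨⟨?_, ?_⟩, ?_, ?_⟩, ?_, ?_⟩
  · exact fun m => (hl.tendsto_mul_left m).mono_left hU
  · exact fun m => (hl.tendsto_mul_right m).mono_left hU
  · exact hU hl.eventually_nonneg
  · exact hU hl.eventually_norm
  · simpa using he
  · intro f
    exact ((WeakDual.eval_continuous f).tendsto e).comp hle

end BidualUnit

theorem ContinuousLinearMap.opNorm_le_bitranspose {A B C D : Type*} [NonUnitalCStarAlgebra A]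
    [NonUnitalCStarAlgebra B] [NonUnitalCStarAlgebra C] [NonUnitalCStarAlgebra D]
    {φ : A →L[ℂ] B} {l : Filter A} [l.NeBot] {e : Bidual A}
    (he : ∀ f : StrongDual ℂ A, Tendsto (fun u => f u) l (𝓝 (e f)))
    {ψ : C →L[ℂ] D} (ι : B →⋆ₙₐ[ℂ] D)
    (h : ∀ c, Tendsto (fun u => star (ι (φ u)) * ψ (star c * c)) l (𝓝 (star (ψ c) * ψ c))) :
    ‖ψ‖ ≤ ‖bitranspose φ e‖ := by
  set H := ‖bitranspose φ e‖ with hH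
  have key : ∀ c, ‖ψ c‖ ^ 2 ≤ H * ‖ψ‖ * ‖c‖ ^ 2 := by
    intro c
    set z := ψ (star c * c) with hz
    obtain ⟨g, hg, hgv⟩ := exists_dual_vector'' ℂ (star (ψ c) * ψ c)
    let k : StrongDual ℂ B := LinearMap.mkContinuous
      { toFun := fun b => star (g (star (ι b) * z))
        map_add' := fun _ _ => by simp only [map_add, star_add, add_mul]
        map_smul' := fun r b => by
          simp only [map_smul, star_smul, smul_mul_assoc, star_star, RingHom.id_apply] }
      ‖z‖ fun b => by
        simp only [LinearMap.coe_mk, AddHom.coe_mk, norm_star]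
        refine (g.le_of_opNorm_le hg _).trans ?_
        rw [one_mul, mul_comm ‖z‖]
        refine (norm_mul_le _ _).trans ?_
        rw [norm_star]
        gcongr
        exact NonUnitalStarAlgHom.norm_apply_le ι b
    have hk : ‖k‖ ≤ ‖z‖ := LinearMap.mkContinuous_norm_le _ (norm_nonneg _) _
    have hlim : bitranspose φ e k = star (g (star (ψ c) * ψ c)) :=
      tendsto_nhds_unique (he (k ∘L φ))
        (((continuous_star.comp g.continuous).tendsto _).comp (h c))
    have hzn : ‖z‖ ≤ ‖ψ‖ * ‖c‖ ^ 2 := by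
      rw [sq, ← CStarRing.norm_star_mul_self]
      exact ψ.le_opNorm _
    calc ‖ψ c‖ ^ 2 = ‖star (g (star (ψ c) * ψ c))‖ := by
          rw [norm_star, hgv, sq, CStarRing.norm_star_mul_self]
          simp
      _ ≤ H * ‖k‖ := by
          rw [← hlim]
          exact (bitranspose φ e).le_opNorm k
      _ ≤ H * (‖ψ‖ * ‖c‖ ^ 2) := by gcongr; exact hk.trans hzn
      _ = _ := by ring
  have hψ : ‖ψ‖ ≤ √(H * ‖ψ‖) := by
    refine ψ.opNorm_le_bound (Real.sqrt_nonneg _) fun c => ?_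
    refine le_of_sq_le_sq ((key c).trans_eq ?_) (by positivity)
    rw [mul_pow, Real.sq_sqrt (by positivity)]
  have hsq : ‖ψ‖ ^ 2 ≤ H * ‖ψ‖ := by
    have := pow_le_pow_left₀ (norm_nonneg ψ) hψ 2
    rwa [Real.sq_sqrt (by positivity)] at this
  rcases (norm_nonneg ψ).eq_or_lt with h0 | h0
  · rw [← h0]
    exact norm_nonneg (bitranspose φ e)
  · exact le_of_mul_le_mul_right (by rwa [← sq]) h0

theorem tendsto_star_mul_map_mul {A B : Type*} [NonUnitalCStarAlgebra A]
    [NonUnitalCStarAlgebra B] {φ : A →L[ℂ] B} (hφ : PreservesRangeOrthogonality φ)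
    {l : Filter A} (hl : l.IsApproximateUnit) (a c : A) :
    Tendsto (fun u => star (φ u) * φ (star a * c)) l (𝓝 (star (φ a) * φ c)) := by
  have h : Tendsto (fun u => star (φ (a * u)) * φ c) l (𝓝 (star (φ a) * φ c)) :=
    ((continuous_star.comp φ.continuous).tendsto a |>.comp (hl.tendsto_mul_left a)).mul_const _
  refine h.congr fun u => ?_
  rw [← balanced_of_preservesRangeOrthogonality hφ, star_star]

/-- The embedding of `B` into `M_n(B)` as scalar matrices. -/
def CStarMatrix.scalarHom (B : Type*) [NonUnitalCStarAlgebra B] (n : ℕ) :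
    B →⋆ₙₐ[ℂ] CStarMatrix (Fin n) (Fin n) B where
  toFun b := CStarMatrix.ofMatrix (Matrix.diagonal fun _ => b)
  map_smul' r b := by
    ext i j
    by_cases h : i = j <;> simp [h]
  map_zero' := by
    ext i j
    simp
  map_add' a b := by
    ext i j
    by_cases h : i = j <;> simp [h]
  map_mul' a b := by
    ext i j
    by_cases h : i = j <;> simp [CStarMatrix.mul_apply, Matrix.diagonal_apply, h]
  map_star' b := by
    ext i j
    by_cases h : i = j
    · simp [CStarMatrix.star_apply, h]
    · simp [CStarMatrix.star_apply, h, Ne.symm h]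

theorem CStarMatrix.scalarHom_apply {B : Type*} [NonUnitalCStarAlgebra B] (n : ℕ) (b : B)
    (i j : Fin n) :
    CStarMatrix.scalarHom B n b i j = if i = j then b else 0 := rfl

section Amplification

variable {A B : Type*} [NonUnitalCStarAlgebra A] [PartialOrder A] [StarOrderedRing A]
  [NonUnitalCStarAlgebra B] [PartialOrder B] [StarOrderedRing B]

theorem tendsto_star_scalarHom_mul_amplification {φ : A →L[ℂ] B}
    (hφ : PreservesRangeOrthogonality φ) {l : Filter A} (hl : l.IsApproximateUnit) (n : ℕ)
    (x y : CStarMatrix (Fin n) (Fin n) A) :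
    Tendsto (fun u => star (CStarMatrix.scalarHom B n (φ u)) * amplification φ n (star x * y)) l
      (𝓝 (star (amplification φ n x) * amplification φ n y)) := by
  refine tendsto_pi_nhds.2 fun i => tendsto_pi_nhds.2 fun j => ?_
  have h := tendsto_finsetSum Finset.univ fun (k : Fin n) _ =>
    tendsto_star_mul_map_mul hφ hl (x k i) (y k j)
  have e1 : (star (amplification φ n x) * amplification φ n y) i j =
      ∑ k, star (φ (x k i)) * φ (y k j) := by
    simp [CStarMatrix.mul_apply, CStarMatrix.star_apply, amplification_apply]
  rw [e1]
  refine h.congr fun u => ?_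
  rw [← map_star (CStarMatrix.scalarHom B n)]
  simp [CStarMatrix.mul_apply, CStarMatrix.star_apply, amplification_apply,
    CStarMatrix.scalarHom_apply, Finset.mul_sum]

theorem opNorm_le_opNorm_amplification_one (φ : A →L[ℂ] B) : ‖φ‖ ≤ ‖amplification φ 1‖ := by
  refine φ.opNorm_le_bound (norm_nonneg _) fun a => ?_
  have h : amplification φ 1 (CStarMatrix.scalarHom A 1 a) 0 0 = φ a := by
    rw [amplification_apply, CStarMatrix.scalarHom_apply, if_pos rfl]
  rw [← h]
  refine CStarMatrix.norm_entry_le_norm.trans ?_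
  refine (ContinuousLinearMap.le_opNorm _ _).trans ?_
  gcongr
  exact NonUnitalStarAlgHom.norm_apply_le _ a

end Amplification

theorem proposition4p10 {A B : Type*}
    [NonUnitalCStarAlgebra A] [PartialOrder A] [StarOrderedRing A]
    [NonUnitalCStarAlgebra B] [PartialOrder B] [StarOrderedRing B]
    (φ : A →L[ℂ] B)
    (hrange : PreservesRangeOrthogonality φ)
    (hdomain : PreservesDomainOrthogonality φ)
    (hzero : PreservesZeroProducts φ) :
    IsCompletelyBounded φ ∧ cbNorm φ = ‖φ‖ ∧
      (∃! e : Bidual A, IsBidualOne e) ∧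
      ∀ e : Bidual A, IsBidualOne e → ‖φ‖ = ‖bitranspose φ e‖ := by
  obtain ⟨l, e, hl, he1, he⟩ := exists_tendsto_bidual A
  have := hl.neBot
  have hone := isBidualOne_of_tendsto hl he
  have hle : ‖bitranspose φ e‖ ≤ ‖φ‖ := by
    refine ContinuousLinearMap.opNorm_le_bound _ (norm_nonneg _) fun f => ?_
    rw [bitranspose_apply, mul_comm]
    refine (e.le_of_opNorm_le he1 _).trans ?_
    rw [one_mul]
    exact f.opNorm_comp_le φ
  have hge : ‖φ‖ ≤ ‖bitranspose φ e‖ :=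
    ContinuousLinearMap.opNorm_le_bitranspose he (NonUnitalStarAlgHom.id ℂ B) fun c =>
      tendsto_star_mul_map_mul hrange hl.toIsApproximateUnit c c
  have hamp : ∀ n, ‖amplification φ n‖ ≤ ‖φ‖ := fun n =>
    (ContinuousLinearMap.opNorm_le_bitranspose he (CStarMatrix.scalarHom B n) fun c =>
      tendsto_star_scalarHom_mul_amplification hrange hl.toIsApproximateUnit n c c).trans hle
  have hbdd : IsCompletelyBounded φ := ⟨‖φ‖, by rintro _ ⟨n, rfl⟩; exact hamp n⟩
  refine ⟨hbdd, le_antisymm (ciSup_le hamp) ?_, ⟨e, hone, fun _ h => eq_of_isBidualOne h hone⟩,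
    fun e' h => ?_⟩
  · exact (opNorm_le_opNorm_amplification_one φ).trans (le_ciSup hbdd 1)
  · rw [eq_of_isBidualOne h hone]
    exact le_antisymm hge hle
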